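/- Let $N\ge 1$, let $Q=(0,1)^N$, and let all function spaces be complex. Let $H^1(T^N)$ be the space of all $u\in L^2(Q)$ whose weak derivatives on the torus, tested against smooth $\mathbb Z^N$-periodic functions, lie in $L^2(Q)$. Let $H^1_0(Q)\subset H^1(T^N)$ be the closure of $\mathcal D(Q)=C_c^\infty(Q)$ in the $H^1$-norm, and put $$H^1_m(T^N)=\Big\{u\in H^1(T^N):\int_Q u\,dx=0\Big\},\qquad \mathrm{Har}(T^N)=\Big\{u\in H^1(T^N):\int_Q\nabla u\cdot\overline{\nabla v}\,dx=0\ \ \forall v\in H^1_0(Q)\Big\}.$$ Let $V_0$ be the closure of $\mathrm{Har}(T^N)$ in $L^2(Q)$, and let $\tilde V=\{f\in L^2(Q): \int_Q f\bar g\,dx=0\ \ \forall g\in \mathrm{Har}(T^N)\}$. Let $H^{-1}(T^N)$ and $H^{-1}(Q)$ be the spaces of continuous conjugate-linear functionals on $H^1(T^N)$ and $H^1_0(Q)$, respectively, with $L^2(Q)\hookrightarrow H^{-1}(T^N)$ given by $\langle f,v\rangle=\int_Q f\bar v\,dx$. Let $\mu_0(f)=\langle f,1\rangle$, and let $$H=\{w\in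 H^{-1}(T^N):\langle w,v\rangle=0\ \ \forall v\in\mathrm{Har}(T^N)\}.$$ Let $\mathrm{Id}_m:H\to H^{-1}(Q)$ be the restriction of functionals to $H^1_0(Q)$. For $f\in H^{-1}(T^N)$ let $u_f\in H^1_m(T^N)$ be the solution of $\operatorname{div}\nabla u_f=f-\mu_0(f)$, i.e. $\int_Q\nabla u_f\cdot\overline{\nabla v}\,dx=-\langle f-\mu_0(f),v\rangle$ for all $v\in H^1(T^N)$. Let $\tilde A$ be the operator associated in $H$ with the form $a(f,h)=\int_Q f\bar h\,dx$ with form domain $\tilde V$, i.e. $$D(\tilde A)=\Big\{f\in\tilde V:\ \exists g\in H:\ a(f,h)=\int_Q\nabla u_g\cdot\overline{\nabla u_h}\,dx\ \ \forall h\in\tilde V\Big\},\qquad \tilde Af=g .$$ **Theorem.** These objects are well defined: $u_f$ exists and is unique for every $f\in H^{-1}(T^N)$, the element $g$ in the definition of $\tilde A$ is unique, and $\mathrm{Id}_m$ is an isomorphism of $H$ onto $H^{-1}(Q)$. Moreover $$D(\tilde A)=\tilde V\cap\big(H^1_m(T^N)+V_0\big),$$ and for every $f\in D(\tilde A)$ the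 distributional Laplacian $\Delta f\in\mathcal D'(Q)$ belongs to $H^{-1}(Q)$ (that is, it extends to a continuous functional on $H^1_0(Q)$) and $$\tilde Af=-\mathrm{Id}_m^{-1}\Delta f .$$ -/

import Mathlib

open MeasureTheory Set
open scoped ENNReal ContDiff ComplexConjugate

noncomputable section

namespace TorusMoment

/-! ### The cube, its `L²` space, and test functions -/

/-- The open unit cube `(0,1)^N`. -/
def cube (N : ℕ) : Set (Fin N → ℝ) := Set.pi univ fun _ => Ioo 0 1

/-- Lebesgue measure on the open unit cube. -/
abbrev cubeMeasure (N : ℕ) : Measure (Fin N → ℝ) := volume.restrict (cube N)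

/-- Complex `L²((0,1)^N)`, also written `L²(T^N)`. -/
abbrev L2 (N : ℕ) : Type := Lp ℂ 2 (cubeMeasure N)

/-- The sesquilinear form `a(f,g) = ∫_{(0,1)^N} f \bar g`. -/
def l2Form {N : ℕ} (f g : L2 N) : ℂ := ∫ x in cube N, f x * conj (g x)

/-- The `i`-th classical partial derivative. -/
def pderiv {N : ℕ} (i : Fin N) (φ : (Fin N → ℝ) → ℂ) (x : Fin N → ℝ) : ℂ :=
  fderiv ℝ φ x (Pi.single i 1)

/-- The classical Laplacian. -/
def laplacian {N : ℕ} (φ : (Fin N → ℝ) → ℂ) (x : Fin N → ℝ) : ℂ :=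
  ∑ i, pderiv i (pderiv i φ) x

/-- Smooth `ℤ^N`-periodic functions, i.e. smooth functions on the torus `T^N`. -/
structure IsPeriodicTest {N : ℕ} (φ : (Fin N → ℝ) → ℂ) : Prop where
  smooth : ContDiff ℝ ∞ φ
  periodic : ∀ (i : Fin N) (x : Fin N → ℝ), φ (x + Pi.single i 1) = φ x

/-- Test functions on the open cube: smooth with compact support contained in `(0,1)^N`. -/
structure IsCubeTest {N : ℕ} (ψ : (Fin N → ℝ) → ℂ) : Prop where
  smooth : ContDiff ℝ ∞ ψ
  compact : HasCompactSupport ψ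
  supp : tsupport ψ ⊆ cube N

/-- The space `𝒟((0,1)^N)` of test functions on the open cube. -/
abbrev CubeTest (N : ℕ) : Type := {ψ : (Fin N → ℝ) → ℂ // IsCubeTest ψ}

lemma isOpen_cube (N : ℕ) : IsOpen (cube N) :=
  isOpen_set_pi finite_univ fun _ _ => isOpen_Ioo

lemma cube_subset_Icc (N : ℕ) : cube N ⊆ Icc (0 : Fin N → ℝ) 1 := fun _ hx =>
  ⟨fun i => (hx i trivial).1.le, fun i => (hx i trivial).2.le⟩

instance (N : ℕ) : IsFiniteMeasure (cubeMeasure N) :=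
  ⟨by
    rw [Measure.restrict_apply_univ]
    exact (measure_mono (cube_subset_Icc N)).trans_lt isCompact_Icc.measure_lt_top⟩

lemma memLp_of_continuous {N : ℕ} {φ : (Fin N → ℝ) → ℂ} (hφ : Continuous φ) :
    MemLp φ 2 (cubeMeasure N) := by
  obtain ⟨C, hC⟩ := (isCompact_Icc (a := (0 : Fin N → ℝ)) (b := 1)).exists_bound_of_continuousOn
    hφ.continuousOn
  refine MemLp.of_bound hφ.aestronglyMeasurable C ?_
  filter_upwards [ae_restrict_mem (isOpen_cube N).measurableSet] with x hx
  exact hC x (cube_subset_Icc N hx)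

lemma continuous_pderiv {N : ℕ} {φ : (Fin N → ℝ) → ℂ} (hφ : ContDiff ℝ ∞ φ) (i : Fin N) :
    Continuous (pderiv i φ) :=
  (hφ.continuous_fderiv (by simp)).clm_apply continuous_const

/-- A continuous function on `ℝ^N`, restricted to the cube, as an element of `L²`. -/
def contToL2 {N : ℕ} (φ : (Fin N → ℝ) → ℂ) (hφ : Continuous φ) : L2 N :=
  (memLp_of_continuous hφ).toLp φ

lemma coeFn_contToL2 {N : ℕ} {φ : (Fin N → ℝ) → ℂ} (hφ : Continuous φ) :
    contToL2 φ hφ =ᵐ[cubeMeasure N] φ := MemLp.coeFn_toLp _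

lemma l2Form_eq_inner {N : ℕ} (f g : L2 N) : l2Form f g = inner ℂ g f := by
  rw [L2.inner_def]
  rfl

/-- Integration of an `L²` function against a continuous one, as an inner product. -/
lemma integral_mul_eq_inner {N : ℕ} (f : L2 N) {φ : (Fin N → ℝ) → ℂ} (hφ : Continuous φ) :
    ∫ x in cube N, f x * φ x
      = inner ℂ (contToL2 (fun x => conj (φ x)) (Complex.continuous_conj.comp hφ)) f := by
  rw [L2.inner_def]
  refine integral_congr_ae ?_
  filter_upwards [coeFn_contToL2 (Complex.continuous_conj.comp hφ)] with x hx
  simp only [Function.comp_def] at hx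
  rw [hx]
  simp

/-! ### The Sobolev spaces `H¹(T^N)` and `H¹₀((0,1)^N)`

Sobolev functions are represented together with their weak gradient, as elements `w` of the
Hilbert space `L² × (L²)^N`: `w none` is the function and `w (some i)` its `i`-th weak partial
derivative. The norm is the usual `H¹` norm. -/

/-- The Hilbert space `L² × (L²)^N`. -/
abbrev Jet (N : ℕ) : Type := PiLp 2 fun _ : Option (Fin N) => L2 N

/-- `∫_{(0,1)^N} ∇u · \overline{∇v}`. -/
def dirichlet {N : ℕ} (u v : Jet N) : ℂ := ∑ i : Fin N, l2Form (u (some i)) (v (some i))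

/-- `w (some i)` is the weak `i`-th derivative of `w none` on the torus, i.e. when tested with
smooth periodic functions. -/
def IsTorusSobolev {N : ℕ} (w : Jet N) : Prop :=
  ∀ φ : (Fin N → ℝ) → ℂ, IsPeriodicTest φ → ∀ i : Fin N,
    ∫ x in cube N, w none x * pderiv i φ x = -∫ x in cube N, w (some i) x * φ x

lemma isTorusSobolev_iff {N : ℕ} (w : Jet N) :
    IsTorusSobolev w ↔ ∀ (φ : (Fin N → ℝ) → ℂ) (hφ : IsPeriodicTest φ) (i : Fin N),
      inner ℂ (contToL2 (fun x => conj (pderiv i φ x))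
          (Complex.continuous_conj.comp (continuous_pderiv hφ.smooth i))) (w none)
        + inner ℂ (contToL2 (fun x => conj (φ x))
          (Complex.continuous_conj.comp hφ.smooth.continuous)) (w (some i)) = 0 := by
  refine forall_congr' fun φ => forall_congr' fun hφ => forall_congr' fun i => ?_
  rw [integral_mul_eq_inner _ (continuous_pderiv hφ.smooth i),
    integral_mul_eq_inner _ hφ.smooth.continuous, eq_neg_iff_add_eq_zero]

/-- The Sobolev space `H¹(T^N)` of periodic functions. -/
def H1T (N : ℕ) : Submodule ℂ (Jet N) where
  carrier := {w | IsTorusSobolev w}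
  zero_mem' := by
    simp only [mem_ofPred_eq, isTorusSobolev_iff]
    intro φ hφ i
    simp
  add_mem' {u v} hu hv := by
    simp only [mem_ofPred_eq, isTorusSobolev_iff] at hu hv ⊢
    intro φ hφ i
    have h1 := hu φ hφ i
    have h2 := hv φ hφ i
    simp only [PiLp.add_apply, inner_add_right]
    linear_combination h1 + h2
  smul_mem' c u hu := by
    simp only [mem_ofPred_eq, isTorusSobolev_iff] at hu ⊢
    intro φ hφ i
    have h1 := hu φ hφ i
    simp only [PiLp.smul_apply, inner_smul_right]
    linear_combination c * h1

lemma isClosed_H1T (N : ℕ) : IsClosed (H1T N : Set (Jet N)) := by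
  have : (H1T N : Set (Jet N)) = {w | IsTorusSobolev w} := rfl
  rw [this]
  simp only [isTorusSobolev_iff, ofPred_forall]
  refine isClosed_iInter fun φ => isClosed_iInter fun hφ => isClosed_iInter fun i => ?_
  refine isClosed_eq ?_ continuous_const
  have h (j : Option (Fin N)) : Continuous fun w : Jet N => w j :=
    (PiLp.proj (𝕜 := ℂ) 2 (fun _ : Option (Fin N) => L2 N) j).continuous
  exact (continuous_const.inner (h none)).add (continuous_const.inner (h (some i)))

/-- A test function on the cube together with its classical gradient. -/
def testJet {N : ℕ} (ψ : CubeTest N) : Jet N :=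
  WithLp.toLp 2 fun j => match j with
    | none => contToL2 ψ.1 ψ.2.smooth.continuous
    | some i => contToL2 (pderiv i ψ.1) (continuous_pderiv ψ.2.smooth i)

/-- `H¹₀((0,1)^N)`: the closure of the test functions on the cube in the `H¹` norm. -/
def H10 (N : ℕ) : Submodule ℂ (Jet N) :=
  (Submodule.span ℂ (range (testJet (N := N)))).topologicalClosure

lemma testJet_mem_H10 {N : ℕ} (ψ : CubeTest N) : testJet ψ ∈ H10 N :=
  Submodule.le_topologicalClosure _ (Submodule.subset_span ⟨ψ, rfl⟩)

lemma testJet_mem_H1T {N : ℕ} (ψ : CubeTest N) : testJet ψ ∈ H1T N := by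
  intro φ hφ i
  have e1 : ∫ x in cube N, (testJet ψ none) x * pderiv i φ x
      = ∫ x in cube N, ψ.1 x * pderiv i φ x := by
    refine integral_congr_ae ?_
    filter_upwards [coeFn_contToL2 (N := N) ψ.2.smooth.continuous] with x hx
    have : (testJet ψ none) x = ψ.1 x := hx
    rw [this]
  have e2 : ∫ x in cube N, (testJet ψ (some i)) x * φ x
      = ∫ x in cube N, pderiv i ψ.1 x * φ x := by
    refine integral_congr_ae ?_
    filter_upwards [coeFn_contToL2 (N := N) (continuous_pderiv ψ.2.smooth i)] with x hx
    have : (testJet ψ (some i)) x = pderiv i ψ.1 x := hx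
    rw [this]
  have hz : ∀ x, x ∉ cube N → x ∉ tsupport ψ.1 := fun x hx h => hx (ψ.2.supp h)
  have hcs : HasCompactSupport (pderiv i ψ.1) := ψ.2.compact.fderiv_apply (𝕜 := ℝ) _
  have hd : Differentiable ℝ ψ.1 := ψ.2.smooth.differentiable (by simp)
  have hdφ : Differentiable ℝ φ := hφ.smooth.differentiable (by simp)
  rw [e1, e2, setIntegral_eq_integral_of_forall_compl_eq_zero,
    setIntegral_eq_integral_of_forall_compl_eq_zero]
  · refine integral_mul_fderiv_eq_neg_fderiv_mul_of_integrable ?_ ?_ ?_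
      (fun x _ => hd x) (fun x _ => hdφ x)
    · exact ((continuous_pderiv ψ.2.smooth i).mul
        hφ.smooth.continuous).integrable_of_hasCompactSupport hcs.mul_right
    · exact (ψ.2.smooth.continuous.mul
        (continuous_pderiv hφ.smooth i)).integrable_of_hasCompactSupport ψ.2.compact.mul_right
    · exact (ψ.2.smooth.continuous.mul
        hφ.smooth.continuous).integrable_of_hasCompactSupport ψ.2.compact.mul_right
  · intro x hx
    have : fderiv ℝ ψ.1 x = 0 := by
      by_contra h
      exact hz x hx (support_fderiv_subset ℝ h)
    simp [pderiv, this]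
  · intro x hx
    rw [image_eq_zero_of_notMem_tsupport (hz x hx), zero_mul]

/-- `H¹₀((0,1)^N)` is a (closed) subspace of `H¹(T^N)`. -/
lemma H10_le_H1T (N : ℕ) : H10 N ≤ H1T N := by
  refine Submodule.topologicalClosure_minimal _ (Submodule.span_le.2 ?_) (isClosed_H1T N)
  rintro _ ⟨ψ, rfl⟩
  exact testJet_mem_H1T ψ

/-- The embedding `H¹₀((0,1)^N) → H¹(T^N)`. -/
def inclH10 (N : ℕ) : H10 N →L[ℂ] H1T N where
  toLinearMap := Submodule.inclusion (H10_le_H1T N)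
  cont := continuous_inclusion (H10_le_H1T N)

/-- The embedding `H¹(T^N) → L²((0,1)^N)`. -/
def toL2 (N : ℕ) : H1T N →L[ℂ] L2 N :=
  (PiLp.proj (𝕜 := ℂ) 2 (fun _ : Option (Fin N) => L2 N) none).comp (H1T N).subtypeL

/-- The integral of a periodic smooth function's derivative over the cube vanishes. -/
lemma integral_pderiv_periodic {N : ℕ} {φ : (Fin N → ℝ) → ℂ} (hφ : IsPeriodicTest φ)
    (i : Fin N) : ∫ x in cube N, pderiv i φ x = 0 := by
  cases N with
  | zero => exact i.elim0
  | succ n =>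
    have hd : Differentiable ℝ φ := hφ.smooth.differentiable (by simp)
    have hc := continuous_pderiv hφ.smooth i
    have hae : (cube (n + 1) : Set _) =ᵐ[volume] Icc (0 : Fin (n + 1) → ℝ) 1 := by
      exact Measure.univ_pi_Ioo_ae_eq_Icc (f := (0 : Fin (n + 1) → ℝ)) (g := 1)
    rw [setIntegral_congr_set hae]
    have key := integral_divergence_of_hasFDerivAt_off_countable' (E := ℂ)
      (0 : Fin (n + 1) → ℝ) 1 zero_le_one
      (fun j x => if j = i then φ x else 0) (fun j x => if j = i then fderiv ℝ φ x else 0)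
      ∅ countable_empty ?_ ?_ ?_
    · have l : ∀ x, (∑ j, (if j = i then fderiv ℝ φ x else 0) (Pi.single j 1))
          = pderiv i φ x := by
        intro x
        rw [Finset.sum_eq_single i]
        · simp [pderiv]
        · intro j _ hj
          simp [hj]
        · simp
      simp only [l] at key
      rw [key]
      refine Finset.sum_eq_zero fun j _ => ?_
      by_cases hj : j = i
      · subst hj
        simp only [if_true]
        rw [sub_eq_zero]
        congr 1
        ext y
        rw [← hφ.periodic j (Fin.insertNth j ((0 : Fin (n + 1) → ℝ) j) y)]
        congr 1
        ext k
        refine Fin.succAboveCases j ?_ (fun m => ?_) k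
        · simp
        · simp
      · simp [hj]
    · intro j
      by_cases hj : j = i
      · simpa [hj] using hφ.smooth.continuous.continuousOn
      · simpa [hj] using continuousOn_const
    · intro x _ j
      by_cases hj : j = i
      · simpa [hj] using (hd x).hasFDerivAt
      · simpa [hj] using hasFDerivAt_const (0 : ℂ) x
    · refine ContinuousOn.integrableOn_compact isCompact_Icc ?_
      refine continuousOn_finsetSum _ fun j _ => ?_
      by_cases hj : j = i
      · simpa [hj] using ((hφ.smooth.continuous_fderiv (by simp)).clm_apply
          continuous_const).continuousOn
      · simpa [hj] using continuousOn_const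

/-- The constant function `1` as an element of `H¹(T^N)`. -/
def oneT (N : ℕ) : H1T N :=
  ⟨WithLp.toLp 2 fun j => match j with
    | none => contToL2 (fun _ => 1) continuous_const
    | some _ => 0, by
    intro φ hφ i
    have e1 : ∫ x in cube N, (contToL2 (fun _ => (1 : ℂ)) continuous_const : L2 N) x * pderiv i φ x
        = 0 := by
      rw [← integral_pderiv_periodic hφ i]
      refine integral_congr_ae ?_
      filter_upwards [coeFn_contToL2 (N := N) (φ := fun _ => (1 : ℂ)) continuous_const] with x hx
      rw [hx, one_mul]
    have e2 : ∫ x in cube N, (0 : L2 N) x * φ x = 0 := by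
      rw [← integral_zero (Fin N → ℝ) ℂ (μ := cubeMeasure N)]
      refine integral_congr_ae ?_
      filter_upwards [Lp.coeFn_zero ℂ 2 (cubeMeasure N)] with x hx
      rw [hx, Pi.zero_apply, zero_mul]
    change ∫ x in cube N, (contToL2 (fun _ => (1 : ℂ)) continuous_const : L2 N) x * pderiv i φ x
      = -∫ x in cube N, (0 : L2 N) x * φ x
    rw [e1, e2, neg_zero]⟩

/-! ### Linearity of the forms -/

lemma l2Form_add_left {N : ℕ} (f g h : L2 N) : l2Form (f + g) h = l2Form f h + l2Form g h := by
  simp only [l2Form_eq_inner, inner_add_right]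

lemma l2Form_smul_left {N : ℕ} (c : ℂ) (f h : L2 N) : l2Form (c • f) h = c * l2Form f h := by
  simp only [l2Form_eq_inner, inner_smul_right]

lemma l2Form_zero_left {N : ℕ} (h : L2 N) : l2Form 0 h = 0 := by
  simp only [l2Form_eq_inner, inner_zero_right]

lemma dirichlet_add_left {N : ℕ} (u v w : Jet N) :
    dirichlet (u + v) w = dirichlet u w + dirichlet v w := by
  simp only [dirichlet, PiLp.add_apply, l2Form_add_left, Finset.sum_add_distrib]

lemma dirichlet_smul_left {N : ℕ} (c : ℂ) (u w : Jet N) :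
    dirichlet (c • u) w = c * dirichlet u w := by
  simp only [dirichlet, PiLp.smul_apply, l2Form_smul_left, Finset.mul_sum]

lemma dirichlet_zero_left {N : ℕ} (w : Jet N) : dirichlet 0 w = 0 := by
  simp only [dirichlet, PiLp.zero_apply, l2Form_zero_left, Finset.sum_const_zero]

/-! ### Harmonic functions, mean-zero functions, and the spaces `V₀` and `Ṽ` -/

/-- `Har(T^N)`: the `u ∈ H¹(T^N)` with `∫ ∇u · \overline{∇v} = 0` for all `v ∈ H¹₀((0,1)^N)`. -/
def harT (N : ℕ) : Submodule ℂ (H1T N) where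
  carrier := {u | ∀ v ∈ H10 N, dirichlet u.1 v = 0}
  zero_mem' v _ := dirichlet_zero_left v
  add_mem' {u w} hu hw v hv := by
    rw [Submodule.coe_add, dirichlet_add_left, hu v hv, hw v hv, add_zero]
  smul_mem' c u hu v hv := by
    rw [Submodule.coe_smul, dirichlet_smul_left, hu v hv, mul_zero]

/-- `H¹_m(T^N)`: the `u ∈ H¹(T^N)` with `∫_{(0,1)^N} u = 0`. -/
def H1mT (N : ℕ) : Submodule ℂ (H1T N) where
  carrier := {u | ∫ x in cube N, toL2 N u x = 0}
  zero_mem' := by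
    rw [mem_ofPred_eq, map_zero, integral_congr_ae (Lp.coeFn_zero ℂ 2 (cubeMeasure N))]
    simp
  add_mem' {u w} hu hw := by
    rw [mem_ofPred_eq] at hu hw ⊢
    rw [map_add, integral_congr_ae (Lp.coeFn_add _ _)]
    simp only [Pi.add_apply]
    rw [integral_add ((Lp.memLp _).integrable (by norm_num))
      ((Lp.memLp _).integrable (by norm_num)), hu, hw, add_zero]
  smul_mem' c u hu := by
    rw [mem_ofPred_eq] at hu ⊢
    rw [map_smul, integral_congr_ae (Lp.coeFn_smul c _)]
    simp only [Pi.smul_apply]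
    rw [integral_smul, hu, smul_zero]

/-- `V₀`: the closure of `Har(T^N)` in `L²((0,1)^N)`. -/
def V0 (N : ℕ) : Submodule ℂ (L2 N) :=
  ((harT N).map (toL2 N : H1T N →ₗ[ℂ] L2 N)).topologicalClosure

/-- `Ṽ`: the `f ∈ L²((0,1)^N)` that are `L²`-orthogonal to `Har(T^N)`. -/
def Vtilde (N : ℕ) : Submodule ℂ (L2 N) where
  carrier := {f | ∀ g ∈ harT N, l2Form f (toL2 N g) = 0}
  zero_mem' _ _ := l2Form_zero_left _
  add_mem' hf hg v hv := by rw [l2Form_add_left, hf v hv, hg v hv, add_zero]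
  smul_mem' c f hf v hv := by rw [l2Form_smul_left, hf v hv, mul_zero]

/-- `H¹_m(T^N)` regarded as a subspace of `L²((0,1)^N)`. -/
def H1mL2 (N : ℕ) : Submodule ℂ (L2 N) := (H1mT N).map (toL2 N : H1T N →ₗ[ℂ] L2 N)

/-! ### Negative order spaces

Dual spaces consist of continuous conjugate-linear functionals, so that the embedding of the
pivot space `L²`, `f ↦ ⟨f, v⟩ = ∫ f \bar v`, is linear. -/

/-- `H^{-1}(T^N)`. -/
abbrev Hneg1T (N : ℕ) : Type := H1T N →L⋆[ℂ] ℂ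

/-- `H^{-1}((0,1)^N) = (H¹₀((0,1)^N))'`. -/
abbrev Hneg1Cube (N : ℕ) : Type := H10 N →L⋆[ℂ] ℂ

/-- The embedding `L²((0,1)^N) → H^{-1}(T^N)`. -/
def pivot {N : ℕ} (f : L2 N) : Hneg1T N := (innerSLFlip ℂ f).comp (toL2 N)

lemma pivot_apply {N : ℕ} (f : L2 N) (v : H1T N) : pivot f v = l2Form f (toL2 N v) := by
  rw [l2Form_eq_inner]
  rfl

/-- The moment of order zero `μ₀(f) = ⟨f, 1⟩`. -/
def mu0 {N : ℕ} (f : Hneg1T N) : ℂ := f (oneT N)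

/-- `H`: the annihilator of `Har(T^N)` in `H^{-1}(T^N)`. -/
def annH (N : ℕ) : Submodule ℂ (Hneg1T N) where
  carrier := {w | ∀ v ∈ harT N, w v = 0}
  zero_mem' _ _ := rfl
  add_mem' {w z} hw hz v hv := by
    rw [add_apply, hw v hv, hz v hv, add_zero]
  smul_mem' c w hw v hv := by
    rw [smul_apply, hw v hv, smul_zero]

/-- The projector `Id : H^{-1}(T^N) → H^{-1}((0,1)^N)`: restriction of functionals to
`H¹₀((0,1)^N)`. -/
def idProj (N : ℕ) : Hneg1T N →ₗ[ℂ] Hneg1Cube N where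
  toFun w := w.comp (inclH10 N)
  map_add' _ _ := rfl
  map_smul' _ _ := rfl

/-- `Id_m`: the restriction of `Id` to `H`. -/
def idM (N : ℕ) : annH N →ₗ[ℂ] Hneg1Cube N := (idProj N).domRestrict (annH N)

/-- `u = u_f`, i.e. `u ∈ H¹_m(T^N)` and `div ∇ u = f - μ₀(f)` in `H^{-1}(T^N)`:
`∫ ∇u · \overline{∇v} = -⟨f - μ₀(f), v⟩` for all `v ∈ H¹(T^N)`. -/
structure IsPotential {N : ℕ} (f : Hneg1T N) (u : H1T N) : Prop where
  mean_zero : u ∈ H1mT N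
  eqn : ∀ v : H1T N, dirichlet u.1 v.1 = -(f v - mu0 f * pivot (toL2 N (oneT N)) v)

/-- `φ ∈ H^{-1}((0,1)^N)` is the Laplacian of `f ∈ L²((0,1)^N)` in the sense of distributions
in `𝒟'((0,1)^N)`. -/
def IsDistribLaplacian {N : ℕ} (f : L2 N) (φ : Hneg1Cube N) : Prop :=
  ∀ ψ : CubeTest N,
    φ ⟨testJet ψ, testJet_mem_H10 ψ⟩ = ∫ x in cube N, f x * conj (laplacian ψ.1 x)

/-! ### The operator associated with the form `a` on `Ṽ` -/

lemma IsPotential.zero {N : ℕ} : IsPotential (0 : Hneg1T N) 0 where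
  mean_zero := (H1mT N).zero_mem
  eqn v := by
    rw [Submodule.coe_zero, dirichlet_zero_left]
    simp [mu0]

lemma IsPotential.add {N : ℕ} {f g : Hneg1T N} {u v : H1T N} (hf : IsPotential f u)
    (hg : IsPotential g v) : IsPotential (f + g) (u + v) where
  mean_zero := (H1mT N).add_mem hf.mean_zero hg.mean_zero
  eqn w := by
    rw [Submodule.coe_add, dirichlet_add_left, hf.eqn, hg.eqn]
    simp only [mu0, add_apply]
    ring

lemma IsPotential.smul {N : ℕ} {f : Hneg1T N} {u : H1T N} (c : ℂ) (hf : IsPotential f u) :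
    IsPotential (c • f) (c • u) where
  mean_zero := (H1mT N).smul_mem c hf.mean_zero
  eqn w := by
    rw [Submodule.coe_smul, dirichlet_smul_left, hf.eqn]
    simp only [mu0, smul_apply, smul_eq_mul]
    ring

/-- The graph of the operator `Ã` associated in `H` with the form `a` on `Ṽ`: the pairs
`(f, g) ∈ Ṽ × H` with `a(f,h) = (g|h)_H = ∫ ∇u_g · \overline{∇u_h}` for all `h ∈ Ṽ`. -/
def AtildeGraph (N : ℕ) : Submodule ℂ (L2 N × annH N) where
  carrier := {p | p.1 ∈ Vtilde N ∧ ∃ ug : H1T N, IsPotential p.2.1 ug ∧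
    ∀ h ∈ Vtilde N, ∀ uh : H1T N, IsPotential (pivot h) uh →
      l2Form p.1 h = dirichlet ug.1 uh.1}
  zero_mem' := ⟨(Vtilde N).zero_mem, 0, IsPotential.zero, fun h _ uh _ => by
    rw [Prod.fst_zero, l2Form_zero_left, Submodule.coe_zero, dirichlet_zero_left]⟩
  add_mem' := by
    rintro p q ⟨hp, u, hu, hpu⟩ ⟨hq, v, hv, hqv⟩
    refine ⟨(Vtilde N).add_mem hp hq, u + v, hu.add hv, fun h hh uh huh => ?_⟩
    rw [Prod.fst_add, l2Form_add_left, Submodule.coe_add, dirichlet_add_left,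
      hpu h hh uh huh, hqv h hh uh huh]
  smul_mem' := by
    rintro c p ⟨hp, u, hu, hpu⟩
    refine ⟨(Vtilde N).smul_mem c hp, c • u, hu.smul c, fun h hh uh huh => ?_⟩
    rw [Prod.smul_fst, l2Form_smul_left, Submodule.coe_smul, dirichlet_smul_left,
      hpu h hh uh huh]

/-- The operator `Ã`, with domain `{f ∈ Ṽ : ∃ g ∈ H, (f, g) ∈ AtildeGraph}` and `Ã f = g`.
(The value is meaningful because `AtildeGraph` is single-valued, which is equivalent to
`(Atilde N).graph = AtildeGraph N`.) -/
def Atilde (N : ℕ) : L2 N →ₗ.[ℂ] annH N := (AtildeGraph N).toLinearPMap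

end TorusMoment

end

open TorusMoment

/-! The form condition defining the operator is an orthogonality condition in disguise. Since 1 is
harmonic, every $g\in H$ has $\mu_0(g)=0$, so $\int\nabla u_g\cdot\overline{\nabla v}=-\langle
g,v\rangle$ for all $v\in H^1(T^N)$. Using this for $h\in\tilde V\subset H$ with $v=u_g$ gives
$\int\nabla u_g\cdot\overline{\nabla u_h}=-\int u_g\bar h$. Hence $\tilde Af=g$ says exactly that
$f+u_g\perp\tilde V$, i.e. $f+u_g\in V_0$ (`mem_AtildeGraph_iff`).

Everything follows from this criterion. Elements of $V_0$ are distributionally harmonic in $Q$, so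
$\Delta f=-\Delta u_g=-\mathrm{Id}_m g$. Writing $f=-u_g+(f+u_g)$ gives one inclusion for the
domain. Conversely, if $f=u+v$ with $u\in H^1_m$ and $v\in V_0$, take $g=-\mathrm{Id}_m^{-1}\Delta
u$; then $u+u_g$ is harmonic and $f+u_g\in V_0$. Finally $g$ is unique because $H^1(T^N)\cap
V_0\subseteq\mathrm{Har}$ (`mem_harT_of_toL2_mem_V0`).

The analytic input is two Poincaré inequalities: on $H^1_m(T^N)$ by Parseval
(`sq_norm_le_gradient`), giving the potentials, and on $H^1_0(Q)$ by integration by parts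
(`norm_le_of_mem_H10`), giving $H^1(T^N)=H^1_0(Q)\oplus\mathrm{Har}$ and so the isomorphism
$\mathrm{Id}_m$. -/

noncomputable section

namespace TorusMoment

/-! ### Riesz representation and projection for forms bounded below -/

section Riesz

variable {K F : Type*} [NormedAddCommGroup K] [InnerProductSpace ℂ K]
  [NormedAddCommGroup F] [InnerProductSpace ℂ F]

lemma injective_of_bounded_below {D : K →L[ℂ] F} {C : ℝ} (hD : ∀ x, ‖x‖ ≤ C * ‖D x‖) :
    Function.Injective D := by
  refine (injective_iff_map_eq_zero D).2 fun x hx => ?_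
  have := hD x
  rw [hx, norm_zero, mul_zero] at this
  exact norm_le_zero_iff.1 this

lemma isClosed_range_of_bounded_below [CompleteSpace K] {D : K →L[ℂ] F} {C : ℝ}
    (hD : ∀ x, ‖x‖ ≤ C * ‖D x‖) : IsClosed (range D) := by
  refine (AddMonoidHomClass.antilipschitz_of_bound (K := C.toNNReal) D fun x => ?_).isClosed_range
    D.uniformContinuous
  exact (hD x).trans (mul_le_mul_of_nonneg_right (Real.le_coe_toNNReal C) (norm_nonneg _))

/-- The Riesz representation theorem for the form `⟪D v, D u⟫`, where `D` is bounded below. -/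
lemma exists_inner_map_eq [CompleteSpace K] [CompleteSpace F] {D : K →L[ℂ] F} {C : ℝ}
    (hD : ∀ x, ‖x‖ ≤ C * ‖D x‖) (l : K →L⋆[ℂ] ℂ) : ∃ u, ∀ v, inner ℂ (D v) (D u) = l v := by
  let e := D.equivRange (injective_of_bounded_below hD) (isClosed_range_of_bounded_below hD)
  have : CompleteSpace D.range := (isClosed_range_of_bounded_below hD).completeSpace_coe
  -- Conjugation makes the conjugate-linear `l` linear, as the Riesz theorem on the closed range of
  -- `D` requires.
  let m : D.range →L[ℂ] ℂ :=
    { toFun := fun y => conj (l (e.symm y))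
      map_add' := by simp
      map_smul' := by simp
      cont := Complex.continuous_conj.comp (l.continuous.comp e.symm.continuous) }
  let r := (InnerProductSpace.toDual ℂ D.range).symm m
  refine ⟨e.symm r, fun v => ?_⟩
  have h1 : D (e.symm r) = r := congrArg Subtype.val (e.apply_symm_apply r)
  have h2 : inner ℂ r (e v) = m (e v) := InnerProductSpace.toDual_symm_apply
  rw [h1, ← inner_conj_symm]
  have h3 : inner ℂ (r : F) (D v) = m (e v) := h2
  rw [h3]
  simp [m]

/-- The projection along the form `⟪D v, D u⟫` onto `K`, where `D ∘ ι` is bounded below. -/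
lemma exists_form_projection [CompleteSpace K] [CompleteSpace F] {K' : Type*}
    [NormedAddCommGroup K'] [InnerProductSpace ℂ K']
    {D : K →L[ℂ] F} {C : ℝ} (hD : ∀ x, ‖x‖ ≤ C * ‖D x‖) (D' : K' →L[ℂ] F) :
    ∃ P : K' →L[ℂ] K, ∀ u v, inner ℂ (D v) (D' u - D (P u)) = 0 := by
  let e := D.equivRange (injective_of_bounded_below hD) (isClosed_range_of_bounded_below hD)
  have : CompleteSpace D.range := (isClosed_range_of_bounded_below hD).completeSpace_coe
  refine ⟨(e.symm : D.range →L[ℂ] K).comp (D.range.orthogonalProjectionOnto.comp D'), fun u v => ?_⟩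
  have h1 : ∀ r, D (e.symm r) = r := fun r => congrArg Subtype.val (e.apply_symm_apply r)
  simp only [ContinuousLinearMap.comp_apply, ContinuousLinearEquiv.coe_coe, h1]
  exact (Submodule.mem_orthogonal _ _).1 (Submodule.sub_starProjection_mem_orthogonal _) _ ⟨v, rfl⟩

end Riesz

/-! ### Fourier series on the cube -/

/-- The exponential `x ↦ e^{2πi n·x}`. -/
def expFun {N : ℕ} (n : Fin N → ℤ) (x : Fin N → ℝ) : ℂ :=
  Complex.exp (∑ i, 2 * Real.pi * Complex.I * n i * x i)

lemma mFourier_coe {N : ℕ} (n : Fin N → ℤ) (x : Fin N → ℝ) :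
    UnitAddTorus.mFourier n (fun i => (x i : UnitAddCircle)) = expFun n x := by
  simp [UnitAddTorus.mFourier, expFun, Complex.exp_sum]

lemma contDiff_expFun {N : ℕ} (n : Fin N → ℤ) : ContDiff ℝ ∞ (expFun n) := by
  unfold expFun
  refine ContDiff.cexp ?_
  refine ContDiff.sum fun i _ => contDiff_const.mul ?_
  exact Complex.ofRealCLM.contDiff.comp (contDiff_apply ℝ ℝ i)

lemma isPeriodicTest_expFun {N : ℕ} (n : Fin N → ℤ) : IsPeriodicTest (expFun n) where
  smooth := contDiff_expFun n
  periodic i x := by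
    rw [← mFourier_coe, ← mFourier_coe]
    congr 1
    ext j
    by_cases h : j = i
    · subst h
      simp
    · simp [h]

lemma pderiv_expFun {N : ℕ} (n : Fin N → ℤ) (i : Fin N) (x : Fin N → ℝ) :
    pderiv i (expFun n) x = 2 * Real.pi * Complex.I * n i * expFun n x := by
  have h : HasFDerivAt (fun x : Fin N → ℝ => ∑ j, 2 * Real.pi * Complex.I * n j * (x j : ℂ))
      (∑ j, (2 * Real.pi * Complex.I * n j) •
        (Complex.ofRealCLM.comp (ContinuousLinearMap.proj j : (Fin N → ℝ) →L[ℝ] ℝ))) x := by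
    refine HasFDerivAt.fun_sum fun j _ => HasFDerivAt.const_mul ?_ _
    exact (Complex.ofRealCLM.comp (ContinuousLinearMap.proj j : (Fin N → ℝ) →L[ℝ] ℝ)).hasFDerivAt
  rw [pderiv, show expFun n = fun x => Complex.exp (∑ j, 2 * Real.pi * Complex.I * n j * (x j : ℂ))
    from rfl, h.cexp.fderiv]
  rw [smul_apply, sum_apply, smul_eq_mul, mul_comm, Finset.sum_eq_single i]
  · simp
  · intro j _ hj
    simp [hj]
  · simp

lemma Ioc_pi_ae_eq_cube (N : ℕ) :
    {x : Fin N → ℝ | ∀ i, x i ∈ Ioc ((0 : Fin N → ℝ) i) ((0 : Fin N → ℝ) i + 1)}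
      =ᵐ[volume] cube N := by
  have h1 := Measure.univ_pi_Ioo_ae_eq_Icc (μ := fun _ : Fin N => (volume : Measure ℝ))
    (f := 0) (g := 1)
  have h2 := Measure.univ_pi_Ioc_ae_eq_Icc (μ := fun _ : Fin N => (volume : Measure ℝ))
    (f := 0) (g := 1)
  have e : {x : Fin N → ℝ | ∀ i, x i ∈ Ioc ((0 : Fin N → ℝ) i) ((0 : Fin N → ℝ) i + 1)}
      = Set.pi univ fun i => Ioc ((0 : Fin N → ℝ) i) ((1 : Fin N → ℝ) i) := by
    ext x
    simp [mem_pi]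
  rw [e]
  exact h2.trans h1.symm

/-- The function on the torus obtained from a function on the cube. -/
def onTorus {N : ℕ} (f : (Fin N → ℝ) → ℂ) (t : UnitAddTorus (Fin N)) : ℂ :=
  f (UnitAddTorus.measurableEquivPiIoc 0 t).1

lemma onTorus_coe {N : ℕ} (f : (Fin N → ℝ) → ℂ) {x : Fin N → ℝ}
    (hx : ∀ i, x i ∈ Ioc ((0 : Fin N → ℝ) i) ((0 : Fin N → ℝ) i + 1)) :
    onTorus f (fun i => (x i : UnitAddCircle)) = f x := by
  have := (UnitAddTorus.measurableEquivPiIoc (0 : Fin N → ℝ)).apply_symm_apply ⟨x, hx⟩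
  rw [UnitAddTorus.coe_symm_measurableEquivPiIoc_apply] at this
  rw [onTorus, this]

lemma setIntegral_Ioc_eq_cube {N : ℕ} {E : Type*} [NormedAddCommGroup E] [NormedSpace ℝ E]
    (f : (Fin N → ℝ) → E) :
    ∫ x in {x : Fin N → ℝ | ∀ i, x i ∈ Ioc ((0 : Fin N → ℝ) i) ((0 : Fin N → ℝ) i + 1)}, f x
      = ∫ x in cube N, f x :=
  setIntegral_congr_set (Ioc_pi_ae_eq_cube N)

lemma measurableSet_Ioc_pi (N : ℕ) : MeasurableSet
    {x : Fin N → ℝ | ∀ i, x i ∈ Ioc ((0 : Fin N → ℝ) i) ((0 : Fin N → ℝ) i + 1)} :=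
  MeasurableSet.univ_pi' fun _ => measurableSet_Ioc

/-- Parseval's identity on the cube. -/
lemma hasSum_sq_fourier {N : ℕ} (f : L2 N) :
    HasSum (fun n : Fin N → ℤ => ‖∫ x in cube N, f x * expFun (-n) x‖ ^ 2) (‖f‖ ^ 2) := by
  -- The torus is identified with the half-open box, which differs from the open cube by a null set;
  -- Parseval is then transported through this identification.
  have hmp := (measurePreserving_subtype_coe (measurableSet_Ioc_pi N)).comp
    (UnitAddTorus.measurePreserving_equivPiIoc (0 : Fin N → ℝ))
  rw [Measure.restrict_congr_set (Ioc_pi_ae_eq_cube N)] at hmp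
  have hF := (Lp.memLp f).comp_measurePreserving hmp
  have hs := UnitAddTorus.hasSum_sq_mFourierCoeff (hF.toLp _)
  have hae := hF.coeFn_toLp
  convert! hs using 1
  · ext n
    congr 2
    rw [UnitAddTorus.mFourierCoeff,
      integral_congr_ae (g := fun t => UnitAddTorus.mFourier (-n) t • onTorus f t)]
    · rw [UnitAddTorus.integral_preimage _ 0, ← setIntegral_Ioc_eq_cube]
      refine setIntegral_congr_fun (measurableSet_Ioc_pi N) fun x hx => ?_
      rw [onTorus_coe _ hx, mFourier_coe, smul_eq_mul, mul_comm]
    · filter_upwards [hae] with t ht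
      rw [ht]
      rfl
  · rw [integral_congr_ae (g := fun t => ‖onTorus f t‖ ^ 2)]
    · rw [UnitAddTorus.integral_preimage _ 0]
      rw [setIntegral_congr_fun (g := fun x => ‖f x‖ ^ 2) (measurableSet_Ioc_pi N)
        fun x hx => by simp only [onTorus_coe _ hx], setIntegral_Ioc_eq_cube]
      rw [← inner_self_eq_norm_sq (𝕜 := ℂ), L2.inner_def, ← integral_re (L2.integrable_inner f f)]
      exact integral_congr_ae (.of_forall fun x => (inner_self_eq_norm_sq (𝕜 := ℂ) (E := ℂ) (f x)))
    · filter_upwards [hae] with t ht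
      rw [ht]
      rfl

/-! ### Poincaré inequality on the torus -/

/-- Exponentials are themselves admissible periodic test functions, so weak derivatives act on
Fourier coefficients as multipliers. -/
lemma fourier_derivative {N : ℕ} {w : Jet N} (hw : IsTorusSobolev w) (n : Fin N → ℤ) (i : Fin N) :
    ∫ x in cube N, w (some i) x * expFun (-n) x
      = 2 * Real.pi * Complex.I * n i * ∫ x in cube N, w none x * expFun (-n) x := by
  have h := hw _ (isPeriodicTest_expFun (-n)) i
  rw [← neg_eq_iff_eq_neg] at h
  rw [← h, ← integral_const_mul, ← integral_neg]
  congr 1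
  ext x
  rw [pderiv_expFun]
  simp only [Pi.neg_apply, Int.cast_neg]
  ring

/-- Parseval reduces this to single frequencies: the mean condition removes $n=0$, and for $n\ne0$
some $n_i\neq0$ gives $|2\pi n_i|\ge1$. -/
lemma sq_norm_le_gradient {N : ℕ} {w : Jet N} (hw : IsTorusSobolev w)
    (h0 : ∫ x in cube N, w none x = 0) : ‖w none‖ ^ 2 ≤ ∑ i, ‖w (some i)‖ ^ 2 := by
  refine hasSum_le (fun n => ?_) (hasSum_sq_fourier (w none))
    (hasSum_sum fun i (_ : i ∈ Finset.univ) => hasSum_sq_fourier (w (some i)))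
  by_cases hn : n = 0
  · subst hn
    simp only [neg_zero]
    have : ∀ x, expFun (0 : Fin N → ℤ) x = 1 := fun x => by simp [expFun]
    simp only [this, mul_one, h0, norm_zero]
    exact le_trans (by simp) (Finset.sum_nonneg fun i _ => sq_nonneg _)
  · obtain ⟨i, hi⟩ := Function.ne_iff.1 hn
    refine le_trans ?_ (Finset.single_le_sum (f := fun i =>
      ‖∫ x in cube N, w (some i) x * expFun (-n) x‖ ^ 2) (fun _ _ => by positivity)
      (Finset.mem_univ i))
    simp only
    rw [fourier_derivative hw, norm_mul, mul_pow]
    refine le_mul_of_one_le_left (by positivity) (one_le_pow₀ ?_)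
    have h1 : (1 : ℝ) ≤ |(n i : ℝ)| := by
      exact_mod_cast Int.one_le_abs hi
    have h2 : (1 : ℝ) ≤ 2 * Real.pi := by linarith [Real.pi_gt_three]
    simp only [norm_mul, Complex.norm_I, Complex.norm_real, Complex.norm_intCast, mul_one,
      Complex.norm_ofNat, Real.norm_eq_abs, abs_of_pos Real.pi_pos]
    nlinarith

/-! ### Poincaré inequality on `H¹₀` -/

lemma CubeTest.eq_zero {N : ℕ} (ψ : CubeTest N) {x : Fin N → ℝ} (hx : x ∉ cube N) : ψ.1 x = 0 :=
  image_eq_zero_of_notMem_tsupport fun h => hx (ψ.2.supp h)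

lemma tsupport_pderiv_subset {N : ℕ} (φ : (Fin N → ℝ) → ℂ) (i : Fin N) :
    tsupport (pderiv i φ) ⊆ tsupport φ := by
  refine closure_minimal (fun x hx => ?_) (isClosed_tsupport φ)
  refine support_fderiv_subset ℝ (f := φ) fun h => hx ?_
  simp [pderiv, h]

lemma contDiff_pderiv {N : ℕ} {φ : (Fin N → ℝ) → ℂ} (hφ : ContDiff ℝ ∞ φ) (i : Fin N) :
    ContDiff ℝ ∞ (pderiv i φ) :=
  (hφ.fderiv_right (m := ∞) (by simp)).clm_apply contDiff_const

lemma IsCubeTest.pderiv {N : ℕ} {ψ : (Fin N → ℝ) → ℂ} (hψ : IsCubeTest ψ) (i : Fin N) :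
    IsCubeTest (pderiv i ψ) where
  smooth := contDiff_pderiv hψ.smooth i
  compact := hψ.compact.fderiv_apply (𝕜 := ℝ) _
  supp := (tsupport_pderiv_subset ψ i).trans hψ.supp

lemma IsCubeTest.conj {N : ℕ} {ψ : (Fin N → ℝ) → ℂ} (hψ : IsCubeTest ψ) :
    IsCubeTest fun x => conj (ψ x) where
  smooth := Complex.conjCLE.contDiff.comp hψ.smooth
  compact := hψ.compact.comp_left (g := conj) (by simp)
  supp := (closure_mono (Function.support_comp_subset (by simp) _)).trans hψ.supp

lemma pderiv_conj {N : ℕ} {φ : (Fin N → ℝ) → ℂ} (hφ : ContDiff ℝ ∞ φ) (i : Fin N)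
    (x : Fin N → ℝ) : pderiv i (fun y => conj (φ y)) x = conj (pderiv i φ x) := by
  have h := (hφ.differentiable (by simp) x).hasFDerivAt
  have h2 := (Complex.conjCLE : ℂ →L[ℝ] ℂ).hasFDerivAt.comp x h
  have h3 : HasFDerivAt (fun y => conj (φ y)) ((Complex.conjCLE : ℂ →L[ℝ] ℂ).comp (fderiv ℝ φ x)) x
    := h2
  rw [pderiv, h3.fderiv]
  rfl

lemma pderiv_coord {N : ℕ} (i : Fin N) (x : Fin N → ℝ) :
    pderiv i (fun y => (y i : ℂ)) x = 1 := by
  have h : HasFDerivAt (fun y : Fin N → ℝ => (y i : ℂ))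
    (Complex.ofRealCLM.comp (ContinuousLinearMap.proj i : (Fin N → ℝ) →L[ℝ] ℝ)) x :=
    (Complex.ofRealCLM.comp (ContinuousLinearMap.proj i : (Fin N → ℝ) →L[ℝ] ℝ)).hasFDerivAt
  rw [pderiv, h.fderiv]
  simp

lemma inner_contToL2 {N : ℕ} {φ ψ : (Fin N → ℝ) → ℂ} (hφ : Continuous φ) (hψ : Continuous ψ) :
    inner ℂ (contToL2 φ hφ) (contToL2 ψ hψ) = ∫ x in cube N, ψ x * conj (φ x) := by
  rw [← l2Form_eq_inner]
  refine integral_congr_ae ?_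
  filter_upwards [coeFn_contToL2 hφ, coeFn_contToL2 hψ] with x h1 h2
  rw [h1, h2]

/-- Integrate $|\psi|^2\,\partial_i x_i$ by parts, using $\partial_i x_i=1$. -/
lemma integral_sq_eq {N : ℕ} (ψ : CubeTest N) (i : Fin N) :
    ∫ x in cube N, ψ.1 x * conj (ψ.1 x)
      = -((∫ x in cube N, pderiv i ψ.1 x * conj (x i * ψ.1 x))
        + ∫ x in cube N, (x i * ψ.1 x) * conj (pderiv i ψ.1 x)) := by
  have hs := ψ.2.smooth
  have hc := hs.continuous
  have hX : Continuous fun x : Fin N → ℝ => (x i : ℂ) := by fun_prop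
  have hXc : ContDiff ℝ ∞ fun x : Fin N → ℝ => (x i : ℂ) :=
    Complex.ofRealCLM.contDiff.comp (contDiff_apply ℝ ℝ i)
  have hXs : Differentiable ℝ fun x : Fin N → ℝ => (x i : ℂ) := by fun_prop
  have hcc : Continuous fun x => conj (ψ.1 x) := ψ.2.conj.smooth.continuous
  have hp := continuous_pderiv hs i
  have hcs : HasCompactSupport fun x => ψ.1 x * conj (ψ.1 x) := ψ.2.compact.mul_right
  have hsm : ContDiff ℝ ∞ fun x => ψ.1 x * conj (ψ.1 x) := hs.mul ψ.2.conj.smooth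
  have hprod : ∀ x, pderiv i (fun x => ψ.1 x * conj (ψ.1 x)) x
      = ψ.1 x * conj (pderiv i ψ.1 x) + conj (ψ.1 x) * pderiv i ψ.1 x := by
    intro x
    rw [← pderiv_conj hs, pderiv,
      fderiv_fun_mul (hs.differentiable (by simp) x) (ψ.2.conj.smooth.differentiable (by simp) x)]
    rfl
  have key := integral_mul_fderiv_eq_neg_fderiv_mul_of_integrable (μ := volume)
    (f := fun x => ψ.1 x * conj (ψ.1 x)) (g := fun x : Fin N → ℝ => (x i : ℂ))
    (v := Pi.single i 1)
    (((continuous_pderiv hsm i).mul hX).integrable_of_hasCompactSupport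
      (HasCompactSupport.mul_right (hcs.fderiv_apply (𝕜 := ℝ) _)))
    ((hsm.continuous.mul (continuous_pderiv hXc i)).integrable_of_hasCompactSupport hcs.mul_right)
    ((hsm.continuous.mul hX).integrable_of_hasCompactSupport hcs.mul_right)
    (fun x _ => hsm.differentiable (by simp) x) (fun x _ => hXs x)
  have e1 : ∀ x, (ψ.1 x * conj (ψ.1 x)) *
      fderiv ℝ (fun x : Fin N → ℝ => (x i : ℂ)) x (Pi.single i 1) = ψ.1 x * conj (ψ.1 x) :=
    fun x => by rw [show fderiv ℝ (fun x : Fin N → ℝ => (x i : ℂ)) x (Pi.single i 1) = 1 from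
      pderiv_coord i x, mul_one]
  have e2 : ∀ x, fderiv ℝ (fun x => ψ.1 x * conj (ψ.1 x)) x (Pi.single i 1) * (x i : ℂ)
      = pderiv i ψ.1 x * conj (x i * ψ.1 x) + (x i * ψ.1 x) * conj (pderiv i ψ.1 x) := by
    intro x
    rw [show fderiv ℝ (fun x => ψ.1 x * conj (ψ.1 x)) x (Pi.single i 1) = _ from hprod x]
    simp only [map_mul, Complex.conj_ofReal]
    ring
  simp only [e1, e2] at key
  rw [← integral_add, setIntegral_eq_integral_of_forall_compl_eq_zero,
    setIntegral_eq_integral_of_forall_compl_eq_zero, key]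
  · intro x hx
    simp [ψ.eq_zero hx]
  · intro x hx
    simp [ψ.eq_zero hx]
  · exact ((hp.mul (Complex.continuous_conj.comp (hX.mul hc))).integrable_of_hasCompactSupport
      (ψ.2.pderiv i).compact.mul_right).integrableOn
  · exact (((hX.mul hc).mul (Complex.continuous_conj.comp hp)).integrable_of_hasCompactSupport
      ψ.2.compact.mul_left.mul_right).integrableOn

/-- Since $0<x_i<1$ on the cube, Cauchy–Schwarz in `integral_sq_eq` yields
$\|\psi\|^2\le2\|\psi\|\,\|\partial_i\psi\|$. -/
lemma norm_testJet_le {N : ℕ} (ψ : CubeTest N) (i : Fin N) :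
    ‖testJet ψ none‖ ≤ 2 * ‖testJet ψ (some i)‖ := by
  have hc := ψ.2.smooth.continuous
  have hp := continuous_pderiv ψ.2.smooth i
  have hX : Continuous fun x : Fin N → ℝ => (x i : ℂ) * ψ.1 x :=
    Continuous.mul (by fun_prop) hc
  have hXle : ‖contToL2 _ hX‖ ≤ ‖contToL2 _ hc‖ := by
    refine Lp.norm_le_norm_of_ae_le ?_
    filter_upwards [coeFn_contToL2 hX, coeFn_contToL2 hc,
      ae_restrict_mem (isOpen_cube N).measurableSet] with x h1 h2 hx
    rw [h1, h2, norm_mul, Complex.norm_real, Real.norm_eq_abs, abs_of_pos (hx i trivial).1]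
    exact mul_le_of_le_one_left (norm_nonneg _) (hx i trivial).2.le
  have key := integral_sq_eq ψ i
  rw [← inner_contToL2 hc hc, ← inner_contToL2 hX hp, ← inner_contToL2 hp hX,
    inner_self_eq_norm_sq_to_K] at key
  change ‖contToL2 _ hc‖ ≤ 2 * ‖contToL2 _ hp‖
  have h1 : ‖contToL2 _ hc‖ ^ 2 ≤ 2 * (‖contToL2 _ hc‖ * ‖contToL2 _ hp‖) := by
    have := congrArg norm key
    rw [norm_neg] at this
    have e : ‖((‖contToL2 _ hc‖ : ℝ) : ℂ) ^ 2‖ = ‖contToL2 _ hc‖ ^ 2 := by simp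
    have h2 := norm_inner_le_norm (𝕜 := ℂ) (contToL2 _ hX) (contToL2 _ hp)
    have h3 := norm_inner_le_norm (𝕜 := ℂ) (contToL2 _ hp) (contToL2 _ hX)
    have h4 := mul_le_mul_of_nonneg_right hXle (norm_nonneg (contToL2 _ hp))
    have h5 := norm_add_le (inner ℂ (contToL2 _ hX) (contToL2 _ hp))
      (inner ℂ (contToL2 _ hp) (contToL2 _ hX))
    have h6 : ‖contToL2 _ hc‖ ^ 2 = ‖inner ℂ (contToL2 _ hX) (contToL2 _ hp) +
      inner ℂ (contToL2 _ hp) (contToL2 _ hX)‖ := e.symm.trans this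
    linarith
  rcases (norm_nonneg (contToL2 _ hc)).eq_or_lt with h0 | h0
  · rw [← h0]
    positivity
  · nlinarith

/-! ### Test functions as a vector space, dense in $H^1_0(Q)$ -/

lemma IsCubeTest.add {N : ℕ} {φ ψ : (Fin N → ℝ) → ℂ} (hφ : IsCubeTest φ) (hψ : IsCubeTest ψ) :
    IsCubeTest (φ + ψ) where
  smooth := hφ.smooth.add hψ.smooth
  compact := hφ.compact.add hψ.compact
  supp := (tsupport_add φ ψ).trans (union_subset hφ.supp hψ.supp)

lemma IsCubeTest.smul {N : ℕ} (c : ℂ) {ψ : (Fin N → ℝ) → ℂ} (hψ : IsCubeTest ψ) :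
    IsCubeTest (c • ψ) where
  smooth := contDiff_const.smul hψ.smooth
  compact := hψ.compact.smul_left (f := fun _ => c)
  supp := (closure_mono (Function.support_const_smul_subset c ψ)).trans hψ.supp

lemma testJet_add {N : ℕ} (φ ψ : CubeTest N) :
    testJet φ + testJet ψ = testJet ⟨φ.1 + ψ.1, φ.2.add ψ.2⟩ := by
  ext1 j
  have hd : ∀ x, fderiv ℝ (φ.1 + ψ.1) x = fderiv ℝ φ.1 x + fderiv ℝ ψ.1 x := fun x =>
    fderiv_add (φ.2.smooth.differentiable (by simp) x) (ψ.2.smooth.differentiable (by simp) x)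
  cases j with
  | none => exact (MemLp.toLp_add (memLp_of_continuous φ.2.smooth.continuous)
      (memLp_of_continuous ψ.2.smooth.continuous)).symm
  | some i =>
    refine (MemLp.toLp_add (memLp_of_continuous (continuous_pderiv φ.2.smooth i))
      (memLp_of_continuous (continuous_pderiv ψ.2.smooth i))).symm.trans ?_
    refine MemLp.toLp_congr _
      (memLp_of_continuous (continuous_pderiv (φ.2.add ψ.2).smooth i)) (.of_forall fun x => ?_)
    simp [pderiv, hd]

lemma testJet_smul {N : ℕ} (c : ℂ) (ψ : CubeTest N) :
    c • testJet ψ = testJet ⟨c • ψ.1, ψ.2.smul c⟩ := by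
  ext1 j
  have hd : ∀ x, fderiv ℝ (c • ψ.1) x = c • fderiv ℝ ψ.1 x := fun x =>
    fderiv_const_smul (ψ.2.smooth.differentiable (by simp) x) c
  cases j with
  | none => exact (MemLp.toLp_const_smul c (memLp_of_continuous ψ.2.smooth.continuous)).symm
  | some i =>
    refine (MemLp.toLp_const_smul c
      (memLp_of_continuous (continuous_pderiv ψ.2.smooth i))).symm.trans ?_
    refine MemLp.toLp_congr _
      (memLp_of_continuous (continuous_pderiv (ψ.2.smul c).smooth i)) (.of_forall fun x => ?_)
    simp [pderiv, hd]

lemma isCubeTest_zero {N : ℕ} : IsCubeTest (0 : (Fin N → ℝ) → ℂ) where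
  smooth := contDiff_const
  compact := HasCompactSupport.zero
  supp := by simp [tsupport]

/-- Test jets already form a subspace, so closed conditions on `H10` need checking only on single
test functions, even when they are not linear. -/
lemma span_range_testJet (N : ℕ) :
    (Submodule.span ℂ (range (testJet (N := N))) : Set (Jet N)) = range testJet := by
  refine subset_antisymm (fun w hw => ?_) Submodule.subset_span
  induction hw using Submodule.span_induction with
  | mem x h => exact h
  | zero =>
    refine ⟨⟨_, (isCubeTest_zero (N := N)).smul 0⟩, ?_⟩
    rw [← testJet_smul 0 ⟨0, isCubeTest_zero⟩, zero_smul]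
  | add x y _ _ hx hy =>
    obtain ⟨φ, rfl⟩ := hx
    obtain ⟨ψ, rfl⟩ := hy
    exact ⟨_, (testJet_add φ ψ).symm⟩
  | smul c x _ hx =>
    obtain ⟨ψ, rfl⟩ := hx
    exact ⟨_, (testJet_smul c ψ).symm⟩

lemma coe_H10 (N : ℕ) : (H10 N : Set (Jet N)) = closure (range testJet) := by
  rw [← span_range_testJet]
  rfl

lemma continuous_jet_apply {N : ℕ} (j : Option (Fin N)) : Continuous fun w : Jet N => w j :=
  (PiLp.proj (𝕜 := ℂ) 2 (fun _ : Option (Fin N) => L2 N) j).continuous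

lemma norm_le_of_mem_H10 {N : ℕ} {w : Jet N} (hw : w ∈ H10 N) (i : Fin N) :
    ‖w none‖ ≤ 2 * ‖w (some i)‖ := by
  have hw' : w ∈ closure (range (testJet (N := N))) := by
    rw [← coe_H10]
    exact hw
  refine closure_minimal (s := range testJet) (t := {w : Jet N | ‖w none‖ ≤ 2 * ‖w (some i)‖})
    ?_ (isClosed_le ?_ ?_) hw'
  · rintro _ ⟨ψ, rfl⟩
    exact norm_testJet_le ψ i
  · exact (continuous_jet_apply none).norm
  · exact continuous_const.mul (continuous_jet_apply (some i)).norm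

/-! ### Periodic extension of test functions -/

/-- The `ℤ^N`-periodic extension of a function on the cube. -/
def periodize {N : ℕ} (ψ : (Fin N → ℝ) → ℂ) (x : Fin N → ℝ) : ℂ := ψ fun i => Int.fract (x i)

lemma periodize_eqOn {N : ℕ} (ψ : (Fin N → ℝ) → ℂ) : EqOn (periodize ψ) ψ (cube N) := by
  intro x hx
  refine congrArg ψ (funext fun i => ?_)
  exact Int.fract_eq_self.2 ⟨(hx i trivial).1.le, (hx i trivial).2⟩

/-- A compact support keeps a positive distance from the boundary; this is what makes the periodic
extension smooth across the integer hyperplanes. -/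
lemma IsCubeTest.exists_margin {N : ℕ} {ψ : (Fin N → ℝ) → ℂ} (hψ : IsCubeTest ψ) :
    ∃ ε > 0, ∀ z, ψ z ≠ 0 → ∀ i, ε < z i ∧ z i < 1 - ε := by
  obtain ⟨δ, hδ, h⟩ := IsCompact.exists_thickening_subset_open hψ.compact (isOpen_cube N) hψ.supp
  refine ⟨δ / 2, by positivity, fun z hz i => ?_⟩
  have hm : ∀ s : ℝ, |s| < δ → z + Pi.single i s ∈ cube N := by
    intro s hs
    refine h (Metric.mem_thickening_iff.2 ⟨z, subset_tsupport _ hz, ?_⟩)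
    rw [dist_eq_norm, add_sub_cancel_left, Pi.norm_single]
    exact hs
  have h1 := (hm (-(δ / 2)) (by rw [abs_neg, abs_of_pos] <;> linarith) i trivial).1
  have h2 := (hm (δ / 2) (by rw [abs_of_pos] <;> linarith) i trivial).2
  simp at h1 h2
  exact ⟨by linarith, by linarith⟩

lemma IsCubeTest.periodize {N : ℕ} {ψ : (Fin N → ℝ) → ℂ} (hψ : IsCubeTest ψ) :
    IsPeriodicTest (periodize ψ) where
  periodic i x := by
    refine congrArg ψ (funext fun j => ?_)
    by_cases h : j = i
    · subst h
      simp
    · simp [h]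
  smooth := by
    obtain ⟨ε, hε, hm⟩ := hψ.exists_margin
    refine contDiff_iff_contDiffAt.2 fun x => ?_
    let k : Fin N → ℝ := fun i => ⌊x i⌋
    -- Near `x` the extension coincides with this single translate of `ψ`. Where the floors of `y`
    -- and `x` differ, the margin `ε` forces both functions to vanish at `y`.
    have hs : ContDiff ℝ ∞ fun y => ψ (y - k) := hψ.smooth.comp (contDiff_id.sub contDiff_const)
    refine hs.contDiffAt.congr_of_eventuallyEq ?_
    filter_upwards [Metric.ball_mem_nhds x hε] with y hy
    have hd : ∀ i, |y i - x i| < ε := fun i => (dist_le_pi_dist y x i).trans_lt hy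
    by_cases hf : ∀ i, ⌊y i⌋ = ⌊x i⌋
    · refine congrArg ψ (funext fun i => ?_)
      rw [Int.fract, hf i]
      rfl
    · have h1 : TorusMoment.periodize ψ y = 0 := by
        by_contra h
        refine hf fun i => ?_
        obtain ⟨h2, h3⟩ := hm _ h i
        have h4 := abs_lt.1 (hd i)
        rw [Int.fract] at h2 h3
        symm
        exact Int.floor_eq_iff.2 ⟨by linarith, by linarith⟩
      have h2 : ψ (y - k) = 0 := by
        by_contra h
        refine hf fun i => ?_
        obtain ⟨h2, h3⟩ := hm _ h i
        simp only [Pi.sub_apply, k] at h2 h3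
        exact Int.floor_eq_iff.2 ⟨by linarith, by linarith⟩
      rw [h1, h2]

lemma pderiv_eqOn {N : ℕ} {φ ψ : (Fin N → ℝ) → ℂ} (h : EqOn φ ψ (cube N)) (i : Fin N) :
    EqOn (pderiv i φ) (pderiv i ψ) (cube N) := fun x hx => by
  rw [pderiv, pderiv,
    Filter.EventuallyEq.fderiv_eq (h.eventuallyEq_of_mem ((isOpen_cube N).mem_nhds hx))]

/-- Functions in `H¹(T^N)` have the same weak derivatives in the open cube. -/
lemma integral_mul_pderiv_cubeTest {N : ℕ} {w : Jet N} (hw : IsTorusSobolev w)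
    {ψ : (Fin N → ℝ) → ℂ} (hψ : IsCubeTest ψ) (i : Fin N) :
    ∫ x in cube N, w none x * pderiv i ψ x = -∫ x in cube N, w (some i) x * ψ x := by
  have hE := periodize_eqOn ψ
  have e1 : ∫ x in cube N, w none x * pderiv i (periodize ψ) x
      = ∫ x in cube N, w none x * pderiv i ψ x :=
    setIntegral_congr_fun (isOpen_cube N).measurableSet fun x hx => by
      simp only [pderiv_eqOn hE i hx]
  have e2 : ∫ x in cube N, w (some i) x * periodize ψ x = ∫ x in cube N, w (some i) x * ψ x :=
    setIntegral_congr_fun (isOpen_cube N).measurableSet fun x hx => by simp only [hE hx]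
  rw [← e1, ← e2]
  exact hw _ hψ.periodize i

lemma continuous_laplacian {N : ℕ} {φ : (Fin N → ℝ) → ℂ} (hφ : ContDiff ℝ ∞ φ) :
    Continuous (laplacian φ) :=
  continuous_finsetSum _ fun i _ => continuous_pderiv (contDiff_pderiv hφ i) i

lemma integral_conj_laplacian_eq_inner {N : ℕ} (f : L2 N) (ψ : CubeTest N) :
    ∫ x in cube N, f x * conj (laplacian ψ.1 x)
      = inner ℂ (contToL2 _ (continuous_laplacian ψ.2.smooth)) f := by
  refine (integral_mul_eq_inner f
    (Complex.continuous_conj.comp (continuous_laplacian ψ.2.smooth))).trans ?_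
  simp

/-- Green's identity, obtained by testing the weak derivative with $\overline{\partial_i\psi}$. It
links the Dirichlet form to the distributional Laplacian. -/
lemma dirichlet_testJet {N : ℕ} {w : Jet N} (hw : IsTorusSobolev w) (ψ : CubeTest N) :
    dirichlet w (testJet ψ) = -∫ x in cube N, w none x * conj (laplacian ψ.1 x) := by
  have h1 : ∀ i, l2Form (w (some i)) (testJet ψ (some i))
      = -∫ x in cube N, w none x * conj (pderiv i (pderiv i ψ.1) x) := by
    intro i
    have := integral_mul_pderiv_cubeTest hw (ψ.2.pderiv i).conj i
    simp only [pderiv_conj (contDiff_pderiv ψ.2.smooth i)] at this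
    rw [this, neg_neg]
    refine integral_congr_ae ?_
    filter_upwards [coeFn_contToL2 (N := N) (continuous_pderiv ψ.2.smooth i)] with x hx
    have : (testJet ψ (some i)) x = pderiv i ψ.1 x := hx
    rw [this]
  simp only [dirichlet, h1, laplacian, map_sum, Finset.mul_sum]
  rw [integral_finsetSum, Finset.sum_neg_distrib]
  intro i _
  refine ((memLp_of_continuous (Complex.continuous_conj.comp (continuous_pderiv
    (contDiff_pderiv ψ.2.smooth i) i))).integrable_mul (Lp.memLp (w none))).congr ?_
  exact .of_forall fun x => mul_comm _ _

/-! ### The gradient as a bounded operator -/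

/-- The gradient `Jet N → (L²)^N`. -/
def gradient (N : ℕ) : Jet N →L[ℂ] PiLp 2 fun _ : Fin N => L2 N :=
  ((PiLp.continuousLinearEquiv 2 ℂ fun _ : Fin N => L2 N).symm :
    (Fin N → L2 N) →L[ℂ] PiLp 2 fun _ : Fin N => L2 N).comp
    (ContinuousLinearMap.pi fun i => PiLp.proj 2 (fun _ : Option (Fin N) => L2 N) (some i))

lemma gradient_apply {N : ℕ} (w : Jet N) (i : Fin N) : gradient N w i = w (some i) := rfl

lemma inner_gradient {N : ℕ} (u v : Jet N) :
    inner ℂ (gradient N v) (gradient N u) = dirichlet u v := by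
  simp only [PiLp.inner_apply, dirichlet, l2Form_eq_inner, gradient_apply]

lemma conj_dirichlet {N : ℕ} (u v : Jet N) : conj (dirichlet u v) = dirichlet v u := by
  rw [← inner_gradient, inner_conj_symm, inner_gradient]

lemma conj_l2Form {N : ℕ} (f g : L2 N) : conj (l2Form f g) = l2Form g f := by
  rw [l2Form_eq_inner, inner_conj_symm, l2Form_eq_inner]

lemma dirichlet_add_right {N : ℕ} (u v w : Jet N) :
    dirichlet u (v + w) = dirichlet u v + dirichlet u w := by
  simp only [← inner_gradient, map_add, inner_add_left]

lemma dirichlet_smul_right {N : ℕ} (c : ℂ) (u w : Jet N) :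
    dirichlet u (c • w) = conj c * dirichlet u w := by
  simp only [← inner_gradient, map_smul, inner_smul_left]

lemma dirichlet_sub_left {N : ℕ} (u v w : Jet N) :
    dirichlet (u - v) w = dirichlet u w - dirichlet v w := by
  simp only [← inner_gradient, map_sub, inner_sub_right]

lemma norm_sq_jet {N : ℕ} (w : Jet N) : ‖w‖ ^ 2 = ‖w none‖ ^ 2 + ‖gradient N w‖ ^ 2 := by
  simp only [PiLp.norm_sq_eq_of_L2, gradient_apply, Fintype.sum_option]

lemma norm_le_two_mul_gradient {N : ℕ} {u : H1T N} (hu : u ∈ H1mT N) :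
    ‖u‖ ≤ 2 * ‖gradient N u.1‖ := by
  have h1 := sq_norm_le_gradient u.2 hu
  have h2 := norm_sq_jet u.1
  have h3 : ‖gradient N u.1‖ ^ 2 = ∑ i, ‖u.1 (some i)‖ ^ 2 := by
    simp only [PiLp.norm_sq_eq_of_L2, gradient_apply]
  refine abs_le_of_sq_le_sq' ?_ (by positivity) |>.2
  rw [mul_pow, Submodule.coe_norm]
  nlinarith [sq_nonneg ‖gradient N u.1‖]

/-- One coordinate direction suffices, and `hN` provides it: $\|w\|^2\le(4+1)\|\nabla w\|^2$. -/
lemma norm_le_three_mul_gradient {N : ℕ} (hN : 1 ≤ N) {w : Jet N} (hw : w ∈ H10 N) :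
    ‖w‖ ≤ 3 * ‖gradient N w‖ := by
  have h1 := norm_le_of_mem_H10 hw ⟨0, hN⟩
  have h2 := norm_sq_jet w
  have h3 : ‖w (some ⟨0, hN⟩)‖ ≤ ‖gradient N w‖ := PiLp.norm_apply_le (gradient N w) ⟨0, hN⟩
  refine abs_le_of_sq_le_sq' ?_ (by positivity) |>.2
  have h4 : ‖w none‖ ≤ 2 * ‖gradient N w‖ := by linarith
  have h5 : ‖w none‖ ^ 2 ≤ (2 * ‖gradient N w‖) ^ 2 := by gcongr
  nlinarith [sq_nonneg ‖gradient N w‖]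

/-! ### Potentials -/

instance (N : ℕ) : CompleteSpace (H1T N) := (isClosed_H1T N).completeSpace_coe

instance (N : ℕ) : CompleteSpace (H10 N) :=
  (Submodule.isClosed_topologicalClosure _).completeSpace_coe

lemma toL2_oneT {N : ℕ} : toL2 N (oneT N) = contToL2 (fun _ => 1) continuous_const := rfl

lemma integral_eq_l2Form_one {N : ℕ} (f : L2 N) :
    ∫ x in cube N, f x = l2Form f (toL2 N (oneT N)) := by
  refine integral_congr_ae ?_
  rw [toL2_oneT]
  filter_upwards [coeFn_contToL2 (N := N) (φ := fun _ => (1 : ℂ)) continuous_const] with x hx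
  rw [hx, map_one, mul_one]

lemma mem_H1mT_iff {N : ℕ} {u : H1T N} : u ∈ H1mT N ↔ l2Form (toL2 N u) (toL2 N (oneT N)) = 0 := by
  rw [← integral_eq_l2Form_one]
  rfl

lemma isClosed_H1mT (N : ℕ) : IsClosed (H1mT N : Set (H1T N)) := by
  have : (H1mT N : Set (H1T N)) = {u | inner ℂ (toL2 N (oneT N)) (toL2 N u) = 0} := by
    ext u
    rw [SetLike.mem_coe, mem_H1mT_iff, l2Form_eq_inner]
    rfl
  rw [this]
  exact isClosed_eq (continuous_const.inner (toL2 N).continuous) continuous_const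

instance (N : ℕ) : CompleteSpace (H1mT N) := (isClosed_H1mT N).completeSpace_coe

lemma volume_cube (N : ℕ) : (volume : Measure (Fin N → ℝ)) (cube N) = 1 := by
  simp [cube, volume_pi_pi]

lemma l2Form_one_one (N : ℕ) : l2Form (toL2 N (oneT N)) (toL2 N (oneT N)) = 1 := by
  rw [← integral_eq_l2Form_one, toL2_oneT, integral_congr_ae (coeFn_contToL2 _)]
  simp [measureReal_def, volume_cube]

lemma dirichlet_one_right {N : ℕ} (u : Jet N) : dirichlet u (oneT N).1 = 0 := by
  refine Finset.sum_eq_zero fun i _ => ?_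
  change l2Form (u (some i)) 0 = 0
  rw [l2Form_eq_inner, inner_zero_left]

lemma dirichlet_one_left {N : ℕ} (u : Jet N) : dirichlet (oneT N).1 u = 0 := by
  rw [← conj_dirichlet, dirichlet_one_right, map_zero]

lemma oneT_mem_harT (N : ℕ) : oneT N ∈ harT N := fun _ _ => dirichlet_one_left _

lemma exists_add_smul_one {N : ℕ} (v : H1T N) : ∃ w ∈ H1mT N, ∃ c : ℂ, v = w + c • oneT N := by
  refine ⟨v - l2Form (toL2 N v) (toL2 N (oneT N)) • oneT N, ?_, _, (sub_add_cancel _ _).symm⟩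
  rw [mem_H1mT_iff, map_sub, map_smul, sub_eq_add_neg, ← neg_smul, l2Form_add_left,
    l2Form_smul_left, l2Form_one_one]
  ring

/-- By the torus Poincaré inequality the Dirichlet form is coercive on $H^1_m$, so Riesz solves the
equation for mean-zero `v`. -/
lemma existsUnique_isPotential {N : ℕ} (f : Hneg1T N) : ∃! u : H1T N, IsPotential f u := by
  let D : H1mT N →L[ℂ] PiLp 2 fun _ : Fin N => L2 N :=
    (gradient N).comp ((H1T N).subtypeL.comp (H1mT N).subtypeL)
  let L : Hneg1T N := -(f - mu0 f • pivot (toL2 N (oneT N)))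
  let l : H1mT N →L⋆[ℂ] ℂ := L.comp (H1mT N).subtypeL
  have hD : ∀ u : H1mT N, ‖u‖ ≤ 2 * ‖D u‖ := fun u => norm_le_two_mul_gradient u.2
  obtain ⟨u, hu⟩ := exists_inner_map_eq (K := H1mT N) hD l
  have hu' : ∀ v ∈ H1mT N,
      dirichlet u.1.1 v.1 = -(f v - mu0 f * pivot (toL2 N (oneT N)) v) := fun v hv => by
    rw [← inner_gradient]
    exact hu ⟨v, hv⟩
  refine ⟨u, ⟨u.2, fun v => ?_⟩, fun w hw => ?_⟩
  -- Constants add no condition: the form vanishes on them, and subtracting $\mu_0(f)$ makes the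
  -- right side vanish as well.
  · obtain ⟨w, hw, c, rfl⟩ := exists_add_smul_one v
    rw [Submodule.coe_add, Submodule.coe_smul, dirichlet_add_right, dirichlet_smul_right,
      dirichlet_one_right, hu' w hw]
    simp only [map_add, map_smulₛₗ, smul_eq_mul, pivot_apply _ (oneT N), l2Form_one_one]
    simp only [mu0]
    ring
  · have hm := (H1mT N).sub_mem hw.mean_zero u.2
    have h := norm_le_two_mul_gradient hm
    have h0 : gradient N (w - u.1).1 = 0 := by
      rw [← inner_self_eq_zero (𝕜 := ℂ), inner_gradient, Submodule.coe_sub, dirichlet_sub_left,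
        ← Submodule.coe_sub, hw.eqn, hu' _ hm, sub_self]
    rw [h0, norm_zero, mul_zero] at h
    exact sub_eq_zero.1 (norm_le_zero_iff.1 h)

/-! ### The decomposition `H¹(T^N) = H¹₀ ⊕ Har(T^N)` and the isomorphism `Id_m` -/

/-- Project along the Dirichlet form; orthogonality of the remainder to $H^1_0$ is precisely
harmonicity. -/
lemma exists_projection_H10 {N : ℕ} (hN : 1 ≤ N) :
    ∃ P : H1T N →L[ℂ] H10 N, ∀ u, u - inclH10 N (P u) ∈ harT N := by
  obtain ⟨P, hP⟩ := exists_form_projection (D := (gradient N).comp (H10 N).subtypeL) (C := 3)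
    (fun u => norm_le_three_mul_gradient hN u.2) ((gradient N).comp (H1T N).subtypeL)
  refine ⟨P, fun u v hv => ?_⟩
  rw [← inner_gradient, Submodule.coe_sub, map_sub]
  exact hP u ⟨v, hv⟩

lemma eq_zero_of_mem_H10_of_mem_harT {N : ℕ} (hN : 1 ≤ N) {p : H10 N}
    (hp : inclH10 N p ∈ harT N) : p = 0 := by
  have h := norm_le_three_mul_gradient hN p.2
  have h0 : gradient N p.1 = 0 := by
    rw [← inner_self_eq_zero (𝕜 := ℂ), inner_gradient]
    exact hp p p.2
  rw [h0, norm_zero, mul_zero] at h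
  exact Subtype.ext (norm_le_zero_iff.1 h)

lemma idM_apply {N : ℕ} (w : annH N) (v : H10 N) : idM N w v = w.1 (inclH10 N v) := rfl

/-- A functional in the kernel vanishes on both $H^1_0$ and $\mathrm{Har}$, which together span
$H^1(T^N)$. -/
lemma idM_injective {N : ℕ} (hN : 1 ≤ N) : Function.Injective (idM N) := by
  obtain ⟨P, hP⟩ := exists_projection_H10 hN
  refine (injective_iff_map_eq_zero _).2 fun w hw => Subtype.ext ?_
  refine ContinuousLinearMap.ext fun u => ?_
  have h1 := w.2 _ (hP u)
  have h2 : w.1 (inclH10 N (P u)) = 0 := by rw [← idM_apply, hw, zero_apply]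
  rw [map_sub, h2, sub_zero] at h1
  exact h1

/-- Extension of functionals by zero on `Har(T^N)`. -/
lemma exists_extension {N : ℕ} (hN : 1 ≤ N) : ∃ P : H1T N →L[ℂ] H10 N,
    ∀ φ : Hneg1Cube N, ∃ h : φ.comp P ∈ annH N, idM N ⟨φ.comp P, h⟩ = φ := by
  obtain ⟨P, hP⟩ := exists_projection_H10 hN
  have hPp : ∀ p, P (inclH10 N p) = p := fun p => by
    refine (sub_eq_zero.1 (eq_zero_of_mem_H10_of_mem_harT hN ?_)).symm
    rw [map_sub]
    exact hP _
  have hPh : ∀ v ∈ harT N, P v = 0 := fun v hv => by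
    refine eq_zero_of_mem_H10_of_mem_harT hN ?_
    have := (harT N).sub_mem hv (hP v)
    rwa [sub_sub_cancel] at this
  refine ⟨P, fun φ => ⟨fun v hv => ?_, ContinuousLinearMap.ext fun p => ?_⟩⟩
  · rw [ContinuousLinearMap.comp_apply, hPh v hv, map_zero]
  · rw [idM_apply, ContinuousLinearMap.comp_apply, hPp]

lemma idM_surjective {N : ℕ} (hN : 1 ≤ N) : Function.Surjective (idM N) := by
  obtain ⟨P, hP⟩ := exists_extension hN
  exact fun φ => ⟨_, (hP φ).2⟩

/-- `Id_m` is an isomorphism of `H` onto `H^{-1}((0,1)^N)`. -/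
lemma exists_idM_equiv {N : ℕ} (hN : 1 ≤ N) :
    ∃ e : annH N ≃L[ℂ] Hneg1Cube N, ∀ w : annH N, e w = idM N w := by
  obtain ⟨P, hP⟩ := exists_extension hN
  let e := LinearEquiv.ofBijective (idM N) ⟨idM_injective hN, idM_surjective hN⟩
  -- The inverse is precomposition with one fixed bounded `P`, hence continuous.
  have he : ∀ φ, (e.symm φ).1 = φ.comp P := fun φ => by
    have : e.symm φ = ⟨φ.comp P, (hP φ).1⟩ := e.symm_apply_eq.2 (hP φ).2.symm
    rw [this]
  have hc : Continuous fun φ : Hneg1Cube N => φ.comp P :=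
    (ContinuousLinearMap.precomp (ρ := starRingEnd ℂ) ℂ P).continuous
  have hc' : Continuous fun w : Hneg1T N => w.comp (inclH10 N) :=
    (ContinuousLinearMap.precomp (ρ := starRingEnd ℂ) ℂ (inclH10 N)).continuous
  refine ⟨{ e with
    continuous_toFun := hc'.comp continuous_subtype_val
    continuous_invFun := ?_ }, fun w => rfl⟩
  refine continuous_induced_rng.2 ?_
  exact hc.congr fun φ => (he φ).symm

/-! ### The spaces `V₀` and `Ṽ` -/

lemma Vtilde_eq_orthogonal (N : ℕ) :
    Vtilde N = ((harT N).map (toL2 N : H1T N →ₗ[ℂ] L2 N))ᗮ := by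
  ext f
  rw [Submodule.mem_orthogonal]
  constructor
  · rintro h _ ⟨g, hg, rfl⟩
    exact (l2Form_eq_inner f (toL2 N g)).symm.trans (h g hg)
  · intro h g hg
    rw [l2Form_eq_inner]
    exact h _ ⟨g, hg, rfl⟩

/-- $\tilde V=\mathrm{Har}^\perp$, and the double orthogonal complement is the closure. -/
lemma mem_V0_iff {N : ℕ} {f : L2 N} : f ∈ V0 N ↔ ∀ h ∈ Vtilde N, l2Form f h = 0 := by
  rw [V0, ← Submodule.orthogonal_orthogonal_eq_closure, ← Vtilde_eq_orthogonal,
    Submodule.mem_orthogonal]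
  simp only [l2Form_eq_inner]

lemma toL2_mem_V0 {N : ℕ} {u : H1T N} (hu : u ∈ harT N) : toL2 N u ∈ V0 N :=
  Submodule.le_topologicalClosure _ ⟨u, hu, rfl⟩

/-- The elements of `V₀` are harmonic in the sense of distributions. -/
lemma integral_conj_laplacian_eq_zero {N : ℕ} {f : L2 N} (hf : f ∈ V0 N) (ψ : CubeTest N) :
    ∫ x in cube N, f x * conj (laplacian ψ.1 x) = 0 := by
  rw [integral_conj_laplacian_eq_inner]
  -- For fixed `ψ` the pairing is $L^2$-continuous, so it suffices to treat $\mathrm{Har}$, where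
  -- Green's identity applies.
  refine closure_minimal (s := ((harT N).map (toL2 N : H1T N →ₗ[ℂ] L2 N) : Set (L2 N)))
    (t := {f | inner ℂ (contToL2 _ (continuous_laplacian ψ.2.smooth)) f = 0}) ?_
    (isClosed_eq (by fun_prop) continuous_const) hf
  rintro _ ⟨u, hu, rfl⟩
  have h := dirichlet_testJet u.2 ψ
  rw [hu _ (testJet_mem_H10 ψ), zero_eq_neg] at h
  exact (integral_conj_laplacian_eq_inner _ ψ).symm.trans h

/-- Continuous functionals on `H¹₀` are determined by their values on test functions. -/
lemma Hneg1Cube.ext_testJet {N : ℕ} {φ χ : Hneg1Cube N}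
    (h : ∀ ψ : CubeTest N, φ ⟨testJet ψ, testJet_mem_H10 ψ⟩ = χ ⟨testJet ψ, testJet_mem_H10 ψ⟩) :
    φ = χ := by
  ext v
  have hd : Dense (range fun ψ : CubeTest N => (⟨testJet ψ, testJet_mem_H10 ψ⟩ : H10 N)) := by
    intro v
    rw [closure_subtype, ← range_comp]
    have := v.2
    rwa [← SetLike.mem_coe, coe_H10] at this
  refine congrFun (Continuous.ext_on hd φ.continuous χ.continuous ?_) v
  rintro _ ⟨ψ, rfl⟩
  exact h ψ

/-- `H¹(T^N) ∩ V₀ ⊆ Har(T^N)`. -/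
lemma mem_harT_of_toL2_mem_V0 {N : ℕ} {u : H1T N} (hu : toL2 N u ∈ V0 N) : u ∈ harT N := by
  intro v hv
  rw [← conj_dirichlet, map_eq_zero, ← inner_gradient]
  have hc : Continuous fun v : Jet N => inner ℂ (gradient N u.1) (gradient N v) :=
    (innerSL ℂ (gradient N u.1)).continuous.comp (gradient N).continuous
  have hv' : v ∈ closure (range (testJet (N := N))) := by rwa [← coe_H10]
  -- By density `v` may be a test function; there Green's identity turns distributional harmonicity
  -- of `u` into orthogonality of gradients.
  refine closure_minimal (t := {v : Jet N | inner ℂ (gradient N u.1) (gradient N v) = 0}) ?_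
    (isClosed_eq hc continuous_const) hv'
  rintro _ ⟨ψ, rfl⟩
  change inner ℂ (gradient N u.1) (gradient N (testJet ψ)) = 0
  rw [inner_gradient, ← conj_dirichlet, map_eq_zero, dirichlet_testJet u.2]
  exact neg_eq_zero.2 (integral_conj_laplacian_eq_zero hu ψ)

lemma IsDistribLaplacian.unique {N : ℕ} {f : L2 N} {φ χ : Hneg1Cube N}
    (hφ : IsDistribLaplacian f φ) (hχ : IsDistribLaplacian f χ) : φ = χ :=
  Hneg1Cube.ext_testJet fun ψ => (hφ ψ).trans (hχ ψ).symm

/-! ### The operator `Ã` -/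

lemma IsPotential.dirichlet_eq {N : ℕ} {w : Hneg1T N} {u : H1T N} (hu : IsPotential w u)
    (hw : w ∈ annH N) (v : H1T N) : dirichlet u.1 v.1 = -w v := by
  have : mu0 w = 0 := hw _ (oneT_mem_harT N)
  rw [hu.eqn, this, zero_mul, sub_zero]

lemma pivot_mem_annH {N : ℕ} {h : L2 N} (hh : h ∈ Vtilde N) : pivot h ∈ annH N := fun v hv => by
  rw [pivot_apply]
  exact hh v hv

lemma dirichlet_potential_pivot {N : ℕ} {h : L2 N} (hh : h ∈ Vtilde N) {uh : H1T N}
    (huh : IsPotential (pivot h) uh) (v : H1T N) :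
    dirichlet v.1 uh.1 = -l2Form (toL2 N v) h := by
  rw [← conj_dirichlet, huh.dirichlet_eq (pivot_mem_annH hh), pivot_apply, map_neg, conj_l2Form]

/-- The equation of $u_h$ tested with $u_g$ converts the $H$-inner product into $-\int u_g\bar h$,
so the form condition becomes $f+u_g\perp\tilde V$. -/
lemma mem_AtildeGraph_iff {N : ℕ} {p : L2 N × annH N} : p ∈ AtildeGraph N ↔
    p.1 ∈ Vtilde N ∧ ∃ ug : H1T N, IsPotential p.2.1 ug ∧ p.1 + toL2 N ug ∈ V0 N := by
  refine and_congr_right fun _ => exists_congr fun ug => and_congr_right fun _ => ?_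
  rw [mem_V0_iff]
  refine forall₂_congr fun h hh => ?_
  obtain ⟨uh, huh, -⟩ := existsUnique_isPotential (pivot h)
  rw [l2Form_add_left]
  constructor
  · intro H
    rw [H uh huh, dirichlet_potential_pivot hh huh, neg_add_cancel]
  · intro H u hu
    rw [dirichlet_potential_pivot hh hu, eq_neg_of_add_eq_zero_left H]

/-- With $f=0$ the potential $u_g$ lies in $V_0$, hence is harmonic, so $g$ vanishes on $H^1_0$.
This is single-valuedness of the graph. -/
lemma snd_eq_zero_of_mem_AtildeGraph {N : ℕ} (hN : 1 ≤ N) (p : L2 N × annH N)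
    (hp : p ∈ AtildeGraph N) (h0 : p.1 = 0) : p.2 = 0 := by
  obtain ⟨-, ug, hug, hV⟩ := mem_AtildeGraph_iff.1 hp
  rw [h0, zero_add] at hV
  have hhar := mem_harT_of_toL2_mem_V0 hV
  refine idM_injective hN (ContinuousLinearMap.ext fun v => ?_)
  rw [idM_apply, ← neg_neg (p.2.1 _), ← hug.dirichlet_eq p.2.2, map_zero]
  exact neg_eq_zero.2 (hhar v v.2)

/-- In the cube $\Delta(f+u_g)=0$, while $\Delta u_g=g$ on test functions. -/
lemma isDistribLaplacian_of_mem_AtildeGraph {N : ℕ} {f : L2 N} {g : annH N}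
    (h : (f, g) ∈ AtildeGraph N) : IsDistribLaplacian f (-idM N g) := by
  obtain ⟨-, ug, hug, hV⟩ := mem_AtildeGraph_iff.1 h
  intro ψ
  have h1 := integral_conj_laplacian_eq_zero hV ψ
  rw [integral_conj_laplacian_eq_inner, inner_add_right, ← integral_conj_laplacian_eq_inner,
    ← integral_conj_laplacian_eq_inner] at h1
  have h2 := dirichlet_testJet ug.2 ψ
  have h3 := hug.dirichlet_eq g.2 ⟨testJet ψ, testJet_mem_H1T ψ⟩
  rw [h2] at h3
  rw [eq_neg_of_add_eq_zero_left h1]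
  exact h3.symm

lemma mem_domain_iff {N : ℕ} (hN : 1 ≤ N) {f : L2 N} :
    (∃ g, (f, g) ∈ AtildeGraph N) ↔ f ∈ Vtilde N ⊓ (H1mL2 N ⊔ V0 N) := by
  rw [Submodule.mem_inf, Submodule.mem_sup]
  constructor
  · rintro ⟨g, hg⟩
    obtain ⟨hf, ug, hug, hV⟩ := mem_AtildeGraph_iff.1 hg
    refine ⟨hf, -toL2 N ug, (H1mL2 N).neg_mem ⟨ug, hug.mean_zero, rfl⟩, _, hV, ?_⟩
    abel
  · rintro ⟨hf, _, ⟨u, hu, rfl⟩, v, hv, rfl⟩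
    -- This functional is $-\Delta u$ on $H^1_0$; its preimage `g` under $\mathrm{Id}_m$ makes `u +
    -- ug` harmonic, so $f+u_g=(u+u_g)+v\in V_0$.
    let l : Hneg1Cube N :=
      (innerSLFlip ℂ (gradient N u.1)).comp ((gradient N).comp (H10 N).subtypeL)
    have hl : ∀ p : H10 N, l p = dirichlet u.1 p.1 := fun p => inner_gradient u.1 p.1
    obtain ⟨g, hg⟩ := idM_surjective hN l
    obtain ⟨ug, hug, -⟩ := existsUnique_isPotential g.1
    refine ⟨g, mem_AtildeGraph_iff.2 ⟨hf, ug, hug, ?_⟩⟩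
    have hhar : u + ug ∈ harT N := fun p hp => by
      rw [Submodule.coe_add, dirichlet_add_left, ← hl ⟨p, hp⟩, ← hg, idM_apply]
      have := hug.dirichlet_eq g.2 (inclH10 N ⟨p, hp⟩)
      rw [← neg_eq_iff_eq_neg] at this
      rw [← this]
      exact neg_add_cancel _
    have := (V0 N).add_mem (toL2_mem_V0 hhar) hv
    rw [map_add] at this
    convert! this using 1
    simp only [ContinuousLinearMap.coe_coe]
    abel

end TorusMoment

end

/-! ### The main theorem -/

open TorusMoment
theorem mainTheorem2 (N : ℕ) (hN : 1 ≤ N) :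
    (∀ f : Hneg1T N, ∃! u : H1T N, IsPotential f u) ∧
    (Atilde N).graph = AtildeGraph N ∧
    ∃ e : annH N ≃L[ℂ] Hneg1Cube N, (∀ w : annH N, e w = idM N w) ∧
      (Atilde N).domain = Vtilde N ⊓ (H1mL2 N ⊔ V0 N) ∧
      ∀ f : (Atilde N).domain,
        (∃ φ : Hneg1Cube N, IsDistribLaplacian (f : L2 N) φ) ∧
        ∀ φ : Hneg1Cube N, IsDistribLaplacian (f : L2 N) φ →
          (Atilde N) f = -(e.symm φ) := by
  have hgraph : (Atilde N).graph = AtildeGraph N :=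
    Submodule.toLinearPMap_graph_eq _ (snd_eq_zero_of_mem_AtildeGraph hN)
  obtain ⟨e, he⟩ := exists_idM_equiv hN
  refine ⟨existsUnique_isPotential, hgraph, e, he, ?_, fun f => ?_⟩
  · ext f
    rw [← mem_domain_iff hN, Atilde, Submodule.toLinearPMap_domain]
    simp
  · have hmem : ((f : L2 N), Atilde N f) ∈ AtildeGraph N := by
      rw [← hgraph]
      exact LinearPMap.mem_graph (Atilde N) f
    have hL := isDistribLaplacian_of_mem_AtildeGraph hmem
    refine ⟨⟨_, hL⟩, fun φ hφ => ?_⟩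
    -- Test functions are dense in $H^1_0$, so any representative of $\Delta f$ equals
    -- $-\mathrm{Id}_m\tilde Af$.
    rw [hφ.unique hL, map_neg, ← he, ContinuousLinearEquiv.symm_apply_apply]
    exact (neg_neg (Atilde N f)).symm
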